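/- **Notions.** A Büchi automaton has an initial state, a finite set of transitions $(p,\sigma,q)$, and a subset of *significant* transitions; an infinite run is accepting if it takes significant transitions infinitely often. $L(\mathcal A,q)$ is the language of $\mathcal A$ started in $q$; $p,q$ are language-equivalent if $L(\mathcal A,p)=L(\mathcal A,q)$. $\mathcal A$ is *history-deterministic* if there is a resolver (a function from finite runs and letters to a next transition on that letter) that induces an accepting run on every word of $L(\mathcal A)$. It is *semantically deterministic* if transitions on the same letter from language-equivalent states lead to language-equivalent states, and *normal* if every non-significant transition lies in a strongly connected component of the graph of non-significant transitions. $\mathrm{reach}(\mathcal A)$ is obtained by redirecting all significant transitions to a new accepting sink (with a significant self-loop on every letter). $\mathcal A$ has *reach-covering* if for every state $p$ there is a state $q$ language-equivalent to $p$ such that the part of $\mathrm{reach}(\mathcal A)$ accessible from $q$ is deterministic, and $p$ simulates $q$ in $\mathrm{reach}(\mathcal A)$ (Eve, moving second from $p$, has a strategy in the simulation game against Adam, moving from $q$, such that her run is accepting whenever Adam's is). $\mathcal A$ is *simplified* if it is semantically deterministic, normal, and has reach-covering. **Blocks and the language.** Let $\Sigma=\{a,b,c,1,\dots,6,\mathsf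 r_1,\dots,\mathsf r_6,y\}$, $E=\{1,2,3\}$, $F=\{4,5,6\}$. A block has positions $p,q,r,s,t$. It *advances* on $e\in E$ from $s$ and $t$, and on $f\in F$ from $r$. Its inner moves are: $a$ leads from every position to $q$; $b$ leads from $p,t$ to $p$ and from $q,r,s$ to $r$; $c$ leads from $p,t$ to $t$ and from $q,r,s$ to $s$; $y$ leads from every position to $p$; a letter of $E\cup F$ on which the position does not advance leads to $p$. For $\alpha\in\{1,\dots,6\}$ let $L_\alpha$ be the set of finite words $u\alpha$ such that $u$ can be read from $p$ by inner moves and ends in a position that advances on $\alpha$. Let $$L_{65}=\Big(\Sigma^*\cdot\bigcup_{\alpha\ne\beta}(L_\alpha+\mathsf r_\alpha)L_\beta L_\beta\cdot\Sigma^*\cdot y\Big)^\omega .$$ **The automaton $\mathcal A_{65}$.** Its states are $I$ (initial), $I_a,I_b,I_c$; $x^\circ_i$ and $x^\square_i$ for $x\in\{p,q,r,s,t\}$, $1\le i\le 6$; and $Y$. Its non-significant transitions are: * from each of $I$ and $I_c$: on $a$ to $I$ and to $I_a$ (a nondeterministic choice), on $b$ to $I$, on $c$ to $I_c$; from $I_a$: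 on $a,c$ to $I_a$, on $b$ to $I_b$; from $I_b$: on $a,c$ to $I_a$, on $b$ to $I_b$; from each of $I,I_a,I_b,I_c$: to $I$ on $y$, and to $I$ on every letter of $E\cup F$ except $E$ from $I_c$ and $F$ from $I_b$; * the inner moves of each of the twelve blocks $x^\circ_i$, $x^\square_i$ ($i$ fixed); * if $x$ advances on $j$: $x^\circ_i\to p^\circ_i$ on $j$ if $j=i$, and $x^\circ_i\to p^\square_j$ and $x^\square_i\to p^\square_j$ on $j$ if $j\ne i$; * $x^\circ_i\to p^\circ_j$ and $x^\square_i\to p^\circ_j$ on $\mathsf r_j$, for all $x,i,j$; * $Y\to Y$ on every letter other than $y$. Its significant transitions are: $I_c\to p^\circ_e$ on $e\in E$; $I_b\to p^\circ_f$ on $f\in F$; $I,I_a,I_b,I_c\to p^\circ_i$ on $\mathsf r_i$; $x^\square_i\to Y$ on $i$ if $x$ advances on $i$; and $Y\to I$ on $y$. **Theorem.** The automaton $\mathcal A_{65}$ has $65$ states, recognises $L_{65}$, is simplified (semantically deterministic, normal, and with reach-covering), and is history-deterministic. -/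

import Mathlib

/-! ### Büchi automata with transition-based acceptance -/

/-- A nondeterministic Büchi automaton over the alphabet `α` with state set `Q`: an initial state,
a set `Δ` of transitions `(p, a, q)`, and a subset `F` of significant transitions. -/
structure BuchiAutomaton (α Q : Type*) where
  init : Q
  Δ : Set (Q × α × Q)
  F : Set (Q × α × Q)
  F_subset : F ⊆ Δ

namespace BuchiAutomaton

variable {α Q Q' : Type*}

/-- `A.IsPath p l q`: the list `l` of transitions is a finite path of `A` from `p` to `q`. -/
def IsPath (A : BuchiAutomaton α Q) : Q → List (Q × α × Q) → Q → Prop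
  | p, [], q => p = q
  | p, e :: l, q => e ∈ A.Δ ∧ e.1 = p ∧ A.IsPath e.2.2 l q

/-- `A.IsRun q w ρ`: the sequence `ρ` of transitions is an infinite path of `A` from `q` whose
edges are labelled in sequence by the letters of `w`. -/
def IsRun (A : BuchiAutomaton α Q) (q : Q) (w : ℕ → α) (ρ : ℕ → Q × α × Q) : Prop :=
  (ρ 0).1 = q ∧ ∀ n, ρ n ∈ A.Δ ∧ (ρ n).2.1 = w n ∧ (ρ n).2.2 = (ρ (n + 1)).1

/-- The sequence `ρ` contains infinitely many significant transitions. -/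
def Accepting (A : BuchiAutomaton α Q) (ρ : ℕ → Q × α × Q) : Prop :=
  ∃ᶠ n in Filter.atTop, ρ n ∈ A.F

/-- The language `L(A, q)` of `A` with initial state `q`. -/
def langFrom (A : BuchiAutomaton α Q) (q : Q) : Set (ℕ → α) :=
  {w | ∃ ρ, A.IsRun q w ρ ∧ A.Accepting ρ}

/-- The language `L(A)`. -/
def lang (A : BuchiAutomaton α Q) : Set (ℕ → α) := A.langFrom A.init

/-- Two states are language-equivalent. -/
def LangEquiv (A : BuchiAutomaton α Q) (p q : Q) : Prop := A.langFrom p = A.langFrom q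

/-! ### History-determinism -/

/-- A resolver maps a finite run of `A` (from the initial state) and a letter `a` to a transition
of `A` on `a` from the endpoint of the run, whenever there is such a transition. -/
def IsResolver (A : BuchiAutomaton α Q) (σ : List (Q × α × Q) → α → Q × α × Q) : Prop :=
  ∀ l q a, A.IsPath A.init l q → (∃ q', (q, a, q') ∈ A.Δ) →
    σ l a ∈ A.Δ ∧ (σ l a).1 = q ∧ (σ l a).2.1 = a

/-- The first `n` transitions chosen by `σ` on the word `w`. -/
def inducedPrefix (σ : List (Q × α × Q) → α → Q × α × Q) (w : ℕ → α) : ℕ → List (Q × α × Q)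
  | 0 => []
  | n + 1 => inducedPrefix σ w n ++ [σ (inducedPrefix σ w n) (w n)]

/-- The sequence of transitions that `σ` induces on the word `w`. -/
def inducedRun (σ : List (Q × α × Q) → α → Q × α × Q) (w : ℕ → α) (n : ℕ) : Q × α × Q :=
  σ (inducedPrefix σ w n) (w n)

/-- `A` is history-deterministic: some resolver induces an accepting run on every word of the
language of `A`. -/
def IsHistoryDeterministic (A : BuchiAutomaton α Q) : Prop :=
  ∃ σ, A.IsResolver σ ∧
    ∀ w ∈ A.lang, A.IsRun A.init w (inducedRun σ w) ∧ A.Accepting (inducedRun σ w)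

/-! ### Simulation -/

/-- Eve's moves when Adam has moved along `l` and Eve plays according to `f`; here `f` gives Eve's
answer to the (nonempty) list of the moves that Adam has made so far. -/
def replies (f : List (Q × α × Q) → Q' × α × Q') (l : List (Q × α × Q)) : List (Q' × α × Q') :=
  l.inits.tail.map f

/-- `(B, q)` simulates `(A, p)`: in the game where in each round Adam moves along a transition of
`A` (his token starting in `p`) and then Eve moves along a transition of `B` on the same letter
(her token starting in `q`), Eve has a strategy `f` that always answers by a legal move and whose
run is accepting whenever Adam's infinite run is accepting. -/
def Simulates (B : BuchiAutomaton α Q') (q : Q') (A : BuchiAutomaton α Q) (p : Q) : Prop :=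
  ∃ f : List (Q × α × Q) → Q' × α × Q',
    (∀ l r, A.IsPath p l r →
      (∃ r', B.IsPath q (replies f l) r') ∧
        (replies f l).map (fun e => e.2.1) = l.map (fun e => e.2.1)) ∧
    (∀ w ρ, A.IsRun p w ρ → A.Accepting ρ →
      B.Accepting (fun n => f ((List.range (n + 1)).map ρ)))

/-! ### Simplified automata -/

/-- The automaton `reach(A)`: all significant transitions are redirected to a new accepting sink
(the state `none`), which has a significant self-loop on every letter; the transitions that are
not significant are kept. -/
def reach (A : BuchiAutomaton α Q) : BuchiAutomaton α (Option Q) where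
  init := some A.init
  Δ := {e | (∃ p a q, (p, a, q) ∈ A.Δ ∧ (p, a, q) ∉ A.F ∧ e = (some p, a, some q)) ∨
    (∃ p a q, (p, a, q) ∈ A.F ∧ e = (some p, a, none)) ∨ ∃ a, e = (none, a, none)}
  F := {e | (∃ p a q, (p, a, q) ∈ A.F ∧ e = (some p, a, none)) ∨ ∃ a, e = (none, a, none)}
  F_subset := fun _ he => Or.inr he

/-- The part of `A` that is accessible from `q` is deterministic. -/
def DeterministicFrom (A : BuchiAutomaton α Q) (q : Q) : Prop :=
  ∀ l r, A.IsPath q l r → ∀ a r₁ r₂, (r, a, r₁) ∈ A.Δ → (r, a, r₂) ∈ A.Δ → r₁ = r₂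

/-- `q` is reach-deterministic: the accessible part of `(reach(A), q)` is deterministic. -/
def ReachDeterministic (A : BuchiAutomaton α Q) (q : Q) : Prop :=
  A.reach.DeterministicFrom (some q)

/-- Every state `p` has a reach-deterministic, language-equivalent state `q` that `p` simulates in
`reach(A)`. -/
def HasReachCovering (A : BuchiAutomaton α Q) : Prop :=
  ∀ p, ∃ q, A.ReachDeterministic q ∧ A.LangEquiv p q ∧
    A.reach.Simulates (some p) A.reach (some q)

/-- Transitions on the same letter from language-equivalent states lead to language-equivalent
states. -/
def IsSemanticallyDeterministic (A : BuchiAutomaton α Q) : Prop :=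
  ∀ p q a p' q', A.LangEquiv p q → (p, a, p') ∈ A.Δ → (q, a, q') ∈ A.Δ → A.LangEquiv p' q'

/-- `p → q` for some non-significant transition. -/
def NonSigEdge (A : BuchiAutomaton α Q) (p q : Q) : Prop :=
  ∃ a, (p, a, q) ∈ A.Δ ∧ (p, a, q) ∉ A.F

/-- Every non-significant transition lies in a strongly connected component of the graph of the
non-significant transitions. -/
def IsNormal (A : BuchiAutomaton α Q) : Prop :=
  ∀ p q, A.NonSigEdge p q → Relation.ReflTransGen A.NonSigEdge q p

/-- Semantically deterministic, normal, and with reach-covering. -/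
def IsSimplified (A : BuchiAutomaton α Q) : Prop :=
  A.IsSemanticallyDeterministic ∧ A.IsNormal ∧ A.HasReachCovering

end BuchiAutomaton

/-! ### The alphabet and the language -/

namespace SuccinctHD

/-- The sixteen letters. The index `i : Fin 6` stands for the number `i + 1`, so `num i` is one of
the letters `1, …, 6` and `reset i` is one of the six reset letters. -/
inductive Letter
  | a | b | c
  | num (i : Fin 6)
  | reset (i : Fin 6)
  | y
  deriving DecidableEq, Fintype

/-- The five positions of a basic block. -/
inductive Pos
  | p | q | r | s | t
  deriving DecidableEq

instance : Fintype Pos := ⟨{.p, .q, .r, .s, .t}, by intro x; cases x <;> decide⟩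

/-- The block advances on the letters `E = {1, 2, 3}` from `s` and `t`, and on the letters
`F = {4, 5, 6}` from `r`. -/
def Pos.advances (x : Pos) (i : Fin 6) : Prop :=
  (i.val < 3 ∧ (x = .s ∨ x = .t)) ∨ (3 ≤ i.val ∧ x = .r)

instance (x : Pos) (i : Fin 6) : Decidable (x.advances i) := by
  unfold Pos.advances; infer_instance

/-- The moves inside a block. There is none on reset letters, nor on a letter on which the block
advances. -/
def Pos.next : Pos → Letter → Option Pos
  | .p, .a => some .q
  | .p, .b => some .p
  | .p, .c => some .t
  | .q, .a => some .q
  | .q, .b => some .r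
  | .q, .c => some .s
  | .r, .a => some .q
  | .r, .b => some .r
  | .r, .c => some .s
  | .s, .a => some .q
  | .s, .b => some .r
  | .s, .c => some .s
  | .t, .a => some .q
  | .t, .b => some .p
  | .t, .c => some .t
  | _, .y => some .p
  | x, .num i => if x.advances i then none else some .p
  | _, .reset _ => none

/-- The states of the classifier: the five positions and the six final states `ℓ₁, …, ℓ₆`. -/
inductive ClassifierState
  | pos (x : Pos)
  | final (i : Fin 6)
  deriving DecidableEq, Fintype

/-- The transitions of the classifier; `none` means that there is no transition. -/
def ClassifierState.step : ClassifierState → Letter → Option ClassifierState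
  | .pos x, .num i => if x.advances i then some (.final i) else some (.pos .p)
  | .pos x, l => (x.next l).map .pos
  | .final _, _ => none

/-- The classifier with final state `ℓᵢ` and initial state `p`, completed by a rejecting sink
`none`. -/
def classifier (i : Fin 6) : DFA Letter (Option ClassifierState) where
  step x l := x.bind (fun z => z.step l)
  start := some (.pos .p)
  accept := {some (.final i)}

/-- The language `Lᵢ` of finite words. -/
def blockLang (i : Fin 6) : Language Letter := (classifier i).accepts

/-- The language `(Lᵢ + resetᵢ) Lⱼ Lⱼ`. -/
def infixLang (i j : Fin 6) : Language Letter :=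
  (blockLang i + ({[Letter.reset i]} : Language Letter)) * blockLang j * blockLang j

/-- The union of the languages `Σ* (Lᵢ + resetᵢ) Lⱼ Lⱼ Σ* y` over all `i ≠ j`. -/
def factorLang : Language Letter :=
  {u | ∃ i j : Fin 6, i ≠ j ∧ ∃ x v z : List Letter,
    v ∈ infixLang i j ∧ u = x ++ v ++ z ++ [Letter.y]}

/-- The `ω`-power of a language `K` of finite words: the infinite concatenations of nonempty words
of `K`, the cuts being at the positions `t 0 = 0 < t 1 < t 2 < …`. -/
def omegaPower {α : Type*} (K : Language α) : Set (ℕ → α) :=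
  {w | ∃ t : ℕ → ℕ, t 0 = 0 ∧ StrictMono t ∧
    ∀ n, (List.range' (t n) (t (n + 1) - t n)).map w ∈ K}

/-- The language `L₆₅`. -/
def L65 : Set (ℕ → Letter) := omegaPower factorLang

/-! ### The automaton -/

/-- The states: the top component `I, I_a, I_b, I_c`, the circular and square copies of the block
for each of the six indices, and the state `Y`. -/
inductive State
  | I | Ia | Ib | Ic
  | circ (x : Pos) (i : Fin 6)
  | sqr (x : Pos) (i : Fin 6)
  | Y
  deriving DecidableEq, Fintype

/-- The states of the top component. -/
def State.IsTop (q : State) : Prop := q = .I ∨ q = .Ia ∨ q = .Ib ∨ q = .Ic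

/-- From these states the top component is left on the letter `num i`. -/
def State.TopAdvances (q : State) (i : Fin 6) : Prop :=
  (i.val < 3 ∧ q = .Ic) ∨ (3 ≤ i.val ∧ q = .Ib)

/-- The non-significant transitions. -/
inductive NonSig : State → Letter → State → Prop
  -- top component, letters `a`, `b`, `c`
  | I_a : NonSig .I .a .I
  | I_a' : NonSig .I .a .Ia
  | I_b : NonSig .I .b .I
  | I_c : NonSig .I .c .Ic
  | Ic_a : NonSig .Ic .a .I
  | Ic_a' : NonSig .Ic .a .Ia
  | Ic_b : NonSig .Ic .b .I
  | Ic_c : NonSig .Ic .c .Ic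
  | Ia_a : NonSig .Ia .a .Ia
  | Ia_b : NonSig .Ia .b .Ib
  | Ia_c : NonSig .Ia .c .Ia
  | Ib_a : NonSig .Ib .a .Ia
  | Ib_b : NonSig .Ib .b .Ib
  | Ib_c : NonSig .Ib .c .Ia
  -- top component, letters `y` and `1, …, 6`
  | top_y (q : State) : q.IsTop → NonSig q .y .I
  | top_num (q : State) (i : Fin 6) : q.IsTop → ¬ q.TopAdvances i → NonSig q (.num i) .I
  -- moves inside a block
  | circ_next (x x' : Pos) (i : Fin 6) (l : Letter) :
      x.next l = some x' → NonSig (.circ x i) l (.circ x' i)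
  | sqr_next (x x' : Pos) (i : Fin 6) (l : Letter) :
      x.next l = some x' → NonSig (.sqr x i) l (.sqr x' i)
  -- moves between blocks
  | circ_same (x : Pos) (i : Fin 6) : x.advances i → NonSig (.circ x i) (.num i) (.circ .p i)
  | circ_other (x : Pos) (i j : Fin 6) :
      x.advances j → j ≠ i → NonSig (.circ x i) (.num j) (.sqr .p j)
  | sqr_other (x : Pos) (i j : Fin 6) :
      x.advances j → j ≠ i → NonSig (.sqr x i) (.num j) (.sqr .p j)
  | circ_reset (x : Pos) (i j : Fin 6) : NonSig (.circ x i) (.reset j) (.circ .p j)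
  | sqr_reset (x : Pos) (i j : Fin 6) : NonSig (.sqr x i) (.reset j) (.circ .p j)
  -- the state `Y`
  | Y_loop (l : Letter) : l ≠ .y → NonSig .Y l .Y

/-- The significant transitions. -/
inductive Sig : State → Letter → State → Prop
  | top_num (q : State) (i : Fin 6) : q.TopAdvances i → Sig q (.num i) (.circ .p i)
  | top_reset (q : State) (i : Fin 6) : q.IsTop → Sig q (.reset i) (.circ .p i)
  | sqr_same (x : Pos) (i : Fin 6) : x.advances i → Sig (.sqr x i) (.num i) .Y
  | Y_y : Sig .Y .y .I

/-- The automaton `𝒜₆₅`. -/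
def A65 : BuchiAutomaton Letter State where
  init := .I
  Δ := {e | NonSig e.1 e.2.1 e.2.2 ∨ Sig e.1 e.2.1 e.2.2}
  F := {e | Sig e.1 e.2.1 e.2.2}
  F_subset := fun _ he => Or.inr he

end SuccinctHD

/-! All states have the same language $L_{65}$, so semantic determinism is immediate. The states
split into three components (top, blocks, `Y`): non-significant transitions stay inside a component,
significant ones lead to the next one cyclically. An accepting run therefore passes from `Y` to `I`
on `y` infinitely often. From such a passage to a later visit of `Y`, the invariant `Witness`
exhibits a factor in some `infixLang i j` with `i ≠ j`; this gives `langFrom_subset`.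

Conversely, a deterministic tracker runs a single block forever and remembers whether the last
advance was on a letter of `F`; this bit decides the choice on `a`. The core is
`not_quiet_factorLang`: from a state in step with the tracker, a word containing v₁v₂v₃ in
`infixLang i j`, `i ≠ j`, and ending in `y` forces a significant transition. If there were none, v₁
would end in `Y`, in `I`, or at the start of a block of index `i`. From `Y` the final `y` is
significant. From a block of index `i`, v₂ leads to the square block of `j`, which v₃ completes.
From `I`, the bit after v₂ predicts the kind of the advance that ends v₃, so v₃ leaves the top.
Every state is in step with some tracker state, so `langFrom_eq` follows, and the tracker yields a
resolver.

Normality holds because each component is strongly connected by non-significant transitions. For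
reach-covering, states outside the top are reach-deterministic, and each top state simulates a
square block whose index fits its guess (`Covers.step`). -/

namespace BuchiAutomaton

variable {α Q Q' : Type*}

/-! ### Paths, simulation strategies and determinism in general Büchi automata -/

theorem isPath_append (A : BuchiAutomaton α Q) (l₁ l₂ : List (Q × α × Q)) (p r : Q) :
    A.IsPath p (l₁ ++ l₂) r ↔ ∃ q, A.IsPath p l₁ q ∧ A.IsPath q l₂ r := by
  induction l₁ generalizing p with
  | nil => simp [IsPath]
  | cons e l₁ ih => simp [IsPath, ih, and_assoc]

theorem isPath_concat (A : BuchiAutomaton α Q) (l : List (Q × α × Q)) (e : Q × α × Q) (p r : Q) :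
    A.IsPath p (l ++ [e]) r ↔ A.IsPath p l e.1 ∧ e ∈ A.Δ ∧ e.2.2 = r := by
  rw [isPath_append]
  constructor
  · rintro ⟨q, h, h₁, rfl, h₂⟩
    exact ⟨h, h₁, h₂⟩
  · rintro ⟨h, h₁, h₂⟩
    exact ⟨_, h, h₁, rfl, h₂⟩

theorem replies_concat (f : List (Q × α × Q) → Q' × α × Q') (l : List (Q × α × Q))
    (e : Q × α × Q) : replies f (l ++ [e]) = replies f l ++ [f (l ++ [e])] := by
  cases l <;> simp [replies, List.inits_append]

/-- A prefix of a run is a path. -/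
theorem IsRun.isPath {A : BuchiAutomaton α Q} {p : Q} {w : ℕ → α} {ρ : ℕ → Q × α × Q}
    (h : A.IsRun p w ρ) (n : ℕ) : A.IsPath p ((List.range n).map ρ) (ρ n).1 := by
  induction n with
  | zero => exact h.1.symm
  | succ n ih =>
    rw [List.range_succ, List.map_append, List.map_singleton, isPath_concat]
    exact ⟨ih, (h.2 n).1, (h.2 n).2.2⟩

/-- A direct simulation, that is, a relation along which Eve can answer every transition so that
significant transitions are answered by significant ones, yields a winning strategy in the
simulation game. -/
theorem simulates_of_direct [Inhabited α] (B : BuchiAutomaton α Q') (A : BuchiAutomaton α Q)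
    (R : Q → Q' → Prop)
    (hR : ∀ p q a p', R p q → (p, a, p') ∈ A.Δ →
      ∃ q', (q, a, q') ∈ B.Δ ∧ R p' q' ∧ ((p, a, p') ∈ A.F → (q, a, q') ∈ B.F))
    {p : Q} {q : Q'} (hpq : R p q) : B.Simulates q A p := by
  classical
  have hg : ∀ (e : Q × α × Q) (s : Q'), ∃ s', R e.1 s → e ∈ A.Δ →
      (s, e.2.1, s') ∈ B.Δ ∧ R e.2.2 s' ∧ (e ∈ A.F → (s, e.2.1, s') ∈ B.F) := by
    intro e s
    by_cases h : R e.1 s ∧ e ∈ A.Δ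
    · obtain ⟨s', hs⟩ := hR _ _ _ _ h.1 h.2
      exact ⟨s', fun _ _ => hs⟩
    · exact ⟨s, fun h₁ h₂ => absurd ⟨h₁, h₂⟩ h⟩
  choose g hg using hg
  let st : List (Q × α × Q) → Q' := fun l => l.foldl (fun s e => g e s) q
  -- Eve's state is a fold over Adam's moves, so her last move joins the folds of `l.dropLast` and
  -- `l`. The default letter concerns only the empty list, which `replies` skips.
  let f : List (Q × α × Q) → Q' × α × Q' := fun l =>
    (st l.dropLast, (l.getLast?.map (fun e => e.2.1)).getD default, st l)
  have hst : ∀ l e, st (l ++ [e]) = g e (st l) := fun l e => by simp [st]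
  have hf : ∀ l e, f (l ++ [e]) = (st l, e.2.1, g e (st l)) := fun l e => by simp [f, hst]
  have key : ∀ l r, A.IsPath p l r → R r (st l) ∧ B.IsPath q (replies f l) (st l) ∧
      (replies f l).map (fun e => e.2.1) = l.map (fun e => e.2.1) := by
    intro l
    induction l using List.reverseRecOn with
    | nil =>
      rintro r rfl
      exact ⟨hpq, rfl, rfl⟩
    | append_singleton l e ih =>
      intro r h
      obtain ⟨h₁, h₂, rfl⟩ := (isPath_concat _ _ _ _ _).1 h
      obtain ⟨i₁, i₂, i₃⟩ := ih _ h₁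
      obtain ⟨g₁, g₂, -⟩ := hg e _ i₁ h₂
      refine ⟨by rwa [hst], ?_, ?_⟩
      · rw [replies_concat, isPath_concat, hf, hst]
        exact ⟨i₂, g₁, rfl⟩
      · rw [replies_concat, List.map_append, List.map_append, i₃, hf]
        rfl
  refine ⟨f, fun l r h => ⟨⟨_, (key l r h).2.1⟩, (key l r h).2.2⟩, fun w ρ hρ hacc => ?_⟩
  refine hacc.mono fun n hn => ?_
  beta_reduce
  rw [List.range_succ, List.map_append, List.map_singleton, hf]
  exact (hg _ _ (key _ _ (hρ.isPath n)).1 (hρ.2 n).1).2.2 hn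

theorem simulates_refl [Inhabited α] (A : BuchiAutomaton α Q) (q : Q) : A.Simulates q A q :=
  simulates_of_direct A A Eq (by rintro p _ a p' rfl h; exact ⟨p', h, rfl, id⟩) rfl

theorem deterministicFrom_of_closed (A : BuchiAutomaton α Q) (S : Q → Prop)
    (hS : ∀ p a p', S p → (p, a, p') ∈ A.Δ → S p')
    (hdet : ∀ p a p₁ p₂, S p → (p, a, p₁) ∈ A.Δ → (p, a, p₂) ∈ A.Δ → p₁ = p₂)
    {q : Q} (hq : S q) : A.DeterministicFrom q := by
  have key : ∀ l q r, S q → A.IsPath q l r → S r := by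
    intro l
    induction l with
    | nil => rintro q r hq rfl; exact hq
    | cons e l ih =>
      rintro q r hq ⟨h₁, rfl, h₂⟩
      exact ih _ _ (hS _ _ _ hq h₁) h₂
  exact fun l r h a r₁ r₂ h₁ h₂ => hdet r a r₁ r₂ (key l q r hq h) h₁ h₂

end BuchiAutomaton

namespace SuccinctHD

instance : Inhabited Letter := ⟨.a⟩

/-- A word lies in the `ω`-power of `K` if from every position on it continues with a word
of `K`. -/
theorem mem_omegaPower_of_forall {α : Type*} {K : Language α} {w : ℕ → α}
    (h : ∀ k, ∃ k', k < k' ∧ (List.range' k (k' - k)).map w ∈ K) : w ∈ omegaPower K := by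
  choose f hf hK using h
  refine ⟨fun n => f^[n] 0, rfl, strictMono_nat_of_lt_succ fun n => ?_, fun n => ?_⟩
  · rw [Function.iterate_succ_apply']
    exact hf _
  · beta_reduce
    rw [Function.iterate_succ_apply']
    exact hK _

/-! ### Runs inside a block -/

/-- The position that is reached from `x` by reading a word by inner moves. -/
def Pos.run (x : Pos) (u : List Letter) : Option Pos := u.foldlM Pos.next x

theorem Pos.run_cons (x : Pos) (l : Letter) (u : List Letter) (z : Pos) :
    x.run (l :: u) = some z ↔ ∃ x', x.next l = some x' ∧ x'.run u = some z := by
  simp [Pos.run, Option.bind_eq_some_iff]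

theorem Pos.run_concat (x : Pos) (u : List Letter) (l : Letter) (z : Pos) :
    x.run (u ++ [l]) = some z ↔ ∃ x', x.run u = some x' ∧ x'.next l = some z := by
  simp [Pos.run, List.foldlM_append, Option.bind_eq_some_iff]

theorem step_eq_pos_iff (x z : Pos) (l : Letter) :
    (ClassifierState.pos x).step l = some (.pos z) ↔ x.next l = some z := by
  revert x z l; decide

theorem step_eq_final_iff (x : Pos) (l : Letter) (i : Fin 6) :
    (ClassifierState.pos x).step l = some (.final i) ↔ l = .num i ∧ x.advances i := by
  revert x l i; decide

theorem classifier_eval_eq_pos_iff (i : Fin 6) (u : List Letter) (x : Pos) :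
    (classifier i).eval u = some (.pos x) ↔ Pos.p.run u = some x := by
  induction u using List.reverseRecOn generalizing x with
  | nil => simp [classifier, Pos.run]
  | append_singleton u l ih =>
    rw [DFA.eval_append_singleton, Pos.run_concat]
    simp only [classifier, Option.bind_eq_some_iff] at ih ⊢
    constructor
    · rintro ⟨z | j, h₁, h₂⟩
      · exact ⟨z, (ih z).1 h₁, (step_eq_pos_iff _ _ _).1 h₂⟩
      · simp [ClassifierState.step] at h₂
    · rintro ⟨z, h₁, h₂⟩
      exact ⟨_, (ih z).2 h₁, (step_eq_pos_iff _ _ _).2 h₂⟩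

/-- Final states of the classifier have no outgoing transitions, so only the last letter can be an
advance. From here on the classifier is replaced by inner moves. -/
theorem mem_blockLang (i : Fin 6) (v : List Letter) :
    v ∈ blockLang i ↔
      ∃ u x, v = u ++ [.num i] ∧ Pos.p.run u = some x ∧ x.advances i := by
  have hacc : v ∈ blockLang i ↔ (classifier i).eval v = some (.final i) := by
    rw [blockLang, DFA.mem_accepts]
    exact Iff.rfl
  rw [hacc]
  induction v using List.reverseRecOn with
  | nil => simp [classifier]
  | append_singleton u l _ =>
    rw [DFA.eval_append_singleton]
    have hstep : ∀ z l, (classifier i).step z l = z.bind (fun z => z.step l) := fun _ _ => rfl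
    rw [hstep, Option.bind_eq_some_iff]
    constructor
    · rintro ⟨z | j, h₁, h₂⟩
      · obtain ⟨rfl, h⟩ := (step_eq_final_iff _ _ _).1 h₂
        exact ⟨u, z, rfl, (classifier_eval_eq_pos_iff _ _ _).1 h₁, h⟩
      · simp [ClassifierState.step] at h₂
    · rintro ⟨u', x, h, hx, hadv⟩
      obtain ⟨rfl, h⟩ := List.append_inj' h rfl
      obtain rfl : l = .num i := by simpa using h
      exact ⟨_, (classifier_eval_eq_pos_iff _ _ _).2 hx, (step_eq_final_iff _ _ _).2 ⟨rfl, hadv⟩⟩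

theorem concat_mem_blockLang {u : List Letter} {x : Pos} {i : Fin 6} (hu : Pos.p.run u = some x)
    (hx : x.advances i) : u ++ [.num i] ∈ blockLang i :=
  (mem_blockLang _ _).2 ⟨u, x, rfl, hu, hx⟩

/-! ### Soundness -/

/-- What an arrival in a state says about the word `u` that has been read from `I`. -/
def Witness (u : List Letter) : State → Prop
  | .I => True
  | .Ia => ∃ u₀ u₁ x, u = u₀ ++ u₁ ∧ Pos.p.run u₁ = some x ∧ (x = .q ∨ x = .s)
  | .Ib => ∃ u₀ u₁, u = u₀ ++ u₁ ∧ Pos.p.run u₁ = some .r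
  | .Ic => ∃ u₀ u₁ x, u = u₀ ++ u₁ ∧ Pos.p.run u₁ = some x ∧ (x = .s ∨ x = .t)
  | .circ x i => ∃ u₀ v u₁, u = u₀ ++ v ++ u₁ ∧ Pos.p.run u₁ = some x ∧
      v ∈ blockLang i + ({[Letter.reset i]} : Language Letter)
  | .sqr x i => ∃ j, j ≠ i ∧ ∃ u₀ v v' u₁, u = u₀ ++ (v ++ v') ++ u₁ ∧ Pos.p.run u₁ = some x ∧
      v ∈ blockLang j + ({[Letter.reset j]} : Language Letter) ∧ v' ∈ blockLang i
  | .Y => ∃ i j, i ≠ j ∧ ∃ u₀ v u₁, u = u₀ ++ v ++ u₁ ∧ v ∈ infixLang i j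

theorem reset_mem (i : Fin 6) :
    [Letter.reset i] ∈ blockLang i + ({[Letter.reset i]} : Language Letter) :=
  (Language.mem_add _ _ _).2 (Or.inr rfl)

/-- Only a suitable suffix has to be read from `p`, so a letter may start a fresh suffix: entering
`Ia` on `a` or `Ic` on `c` needs just that letter. An advance on a new index turns the current
suffix into the next factor; between squares the oldest factor is dropped into the prefix. -/
theorem Witness.step_nonSig {u : List Letter} {q q' : State} {l : Letter} (hu : Witness u q)
    (h : NonSig q l q') : Witness (u ++ [l]) q' := by
  cases h with
  | I_a | I_b | Ic_a | Ic_b | top_y | top_num => trivial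
  | I_a' | Ic_a' | Ia_a | Ib_a => exact ⟨u, [.a], .q, rfl, rfl, .inl rfl⟩
  | I_c | Ic_c => exact ⟨u, [.c], .t, rfl, rfl, .inr rfl⟩
  | Ia_b =>
    obtain ⟨u₀, u₁, x, rfl, h, hx⟩ := hu
    refine ⟨u₀, u₁ ++ [.b], by simp, (Pos.run_concat _ _ _ _).2 ⟨x, h, ?_⟩⟩
    rcases hx with rfl | rfl <;> rfl
  | Ia_c =>
    obtain ⟨u₀, u₁, x, rfl, h, hx⟩ := hu
    refine ⟨u₀, u₁ ++ [.c], .s, by simp, (Pos.run_concat _ _ _ _).2 ⟨x, h, ?_⟩, .inr rfl⟩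
    rcases hx with rfl | rfl <;> rfl
  | Ib_b =>
    obtain ⟨u₀, u₁, rfl, h⟩ := hu
    exact ⟨u₀, u₁ ++ [.b], by simp, (Pos.run_concat _ _ _ _).2 ⟨_, h, rfl⟩⟩
  | Ib_c =>
    obtain ⟨u₀, u₁, rfl, h⟩ := hu
    exact ⟨u₀, u₁ ++ [.c], .s, by simp, (Pos.run_concat _ _ _ _).2 ⟨_, h, rfl⟩, .inr rfl⟩
  | circ_next x x' i l hx =>
    obtain ⟨u₀, v, u₁, rfl, h, hv⟩ := hu
    exact ⟨u₀, v, u₁ ++ [l], by simp, (Pos.run_concat _ _ _ _).2 ⟨_, h, hx⟩, hv⟩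
  | sqr_next x x' i l hx =>
    obtain ⟨j, hj, u₀, v, v', u₁, rfl, h, hv⟩ := hu
    exact ⟨j, hj, u₀, v, v', u₁ ++ [l], by simp, (Pos.run_concat _ _ _ _).2 ⟨_, h, hx⟩, hv⟩
  | circ_same x i hx =>
    obtain ⟨u₀, v, u₁, rfl, h, hv⟩ := hu
    exact ⟨u₀ ++ v, u₁ ++ [.num i], [], by simp, rfl,
      (Language.mem_add _ _ _).2 (.inl (concat_mem_blockLang h hx))⟩
  | circ_other x i j hx hij =>
    obtain ⟨u₀, v, u₁, rfl, h, hv⟩ := hu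
    exact ⟨i, hij.symm, u₀, v, u₁ ++ [.num j], [], by simp, rfl, hv, concat_mem_blockLang h hx⟩
  | sqr_other x i j hx hij =>
    obtain ⟨k, hk, u₀, v, v', u₁, rfl, h, hv, hv'⟩ := hu
    exact ⟨i, hij.symm, u₀ ++ v, v', u₁ ++ [.num j], [], by simp, rfl,
      (Language.mem_add _ _ _).2 (.inl hv'), concat_mem_blockLang h hx⟩
  | circ_reset x i j => exact ⟨u, [.reset j], [], by simp, rfl, reset_mem j⟩
  | sqr_reset x i j => exact ⟨u, [.reset j], [], by simp, rfl, reset_mem j⟩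
  | Y_loop l =>
    obtain ⟨i, j, hij, u₀, v, u₁, rfl, hv⟩ := hu
    exact ⟨i, j, hij, u₀, v, u₁ ++ [l], by simp, hv⟩

theorem Witness.step_sig {u : List Letter} {q q' : State} {l : Letter} (hu : Witness u q)
    (h : Sig q l q') : Witness (u ++ [l]) q' := by
  cases h with
  | top_num _ i hq =>
    rcases hq with ⟨hi, rfl⟩ | ⟨hi, rfl⟩
    · obtain ⟨u₀, u₁, x, rfl, h, hx⟩ := hu
      exact ⟨u₀, u₁ ++ [.num i], [], by simp, rfl,
        (Language.mem_add _ _ _).2 (.inl (concat_mem_blockLang h (.inl ⟨hi, hx⟩)))⟩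
    · obtain ⟨u₀, u₁, rfl, h⟩ := hu
      exact ⟨u₀, u₁ ++ [.num i], [], by simp, rfl,
        (Language.mem_add _ _ _).2 (.inl (concat_mem_blockLang h (.inr ⟨hi, rfl⟩)))⟩
  | top_reset _ i => exact ⟨u, [.reset i], [], by simp, rfl, reset_mem i⟩
  | sqr_same x i hx =>
    obtain ⟨j, hj, u₀, v, v', u₁, rfl, h, hv, hv'⟩ := hu
    exact ⟨j, i, hj, u₀, v ++ v' ++ (u₁ ++ [.num i]), [], by simp,
      Language.append_mem_mul (Language.append_mem_mul hv hv') (concat_mem_blockLang h hx)⟩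
  | Y_y => trivial

/-- The three components that are connected by significant transitions only. -/
def State.component : State → Fin 3
  | .I | .Ia | .Ib | .Ic => 0
  | .circ _ _ | .sqr _ _ => 1
  | .Y => 2

theorem State.component_eq_zero {q : State} : q.component = 0 ↔ q.IsTop := by
  cases q <;> simp [State.component, State.IsTop]

theorem State.TopAdvances.isTop {q : State} {i : Fin 6} (h : q.TopAdvances i) : q.IsTop := by
  rcases h with ⟨-, rfl⟩ | ⟨-, rfl⟩ <;> simp [State.IsTop]

theorem NonSig.component_eq {q q' : State} {l : Letter} (h : NonSig q l q') :
    q'.component = q.component := by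
  cases h with
  | top_y _ h | top_num _ _ h => rw [State.component_eq_zero.2 h]; rfl
  | _ => rfl

/-- Addition in `Fin 3` wraps around, which accounts for the return from `Y` to the top. -/
theorem Sig.component_eq {q q' : State} {l : Letter} (h : Sig q l q') :
    q'.component = q.component + 1 := by
  cases h with
  | top_num _ _ h => rw [State.component_eq_zero.2 h.isTop]; rfl
  | top_reset _ _ h => rw [State.component_eq_zero.2 h]; rfl
  | _ => rfl

theorem Sig.of_component_eq_two {q q' : State} {l : Letter} (h : Sig q l q')
    (hq : q.component = 2) : q = .Y ∧ l = .y ∧ q' = .I := by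
  cases h with
  | top_num _ _ h => rw [State.component_eq_zero.2 h.isTop] at hq; cases hq
  | top_reset _ _ h => rw [State.component_eq_zero.2 h] at hq; cases hq
  | sqr_same => cases hq
  | Y_y => exact ⟨rfl, rfl, rfl⟩

section Soundness

variable {q : State} {w : ℕ → Letter} {ρ : ℕ → State × Letter × State}

/-- The first significant transition from `k` on will do, since the component is constant until
then. The induction is on the distance to some later significant transition. -/
theorem exists_sig_same_component (hρ : A65.IsRun q w ρ) (hacc : A65.Accepting ρ) (k : ℕ) :
    ∃ m, k ≤ m ∧ ρ m ∈ A65.F ∧ (ρ m).1.component = (ρ k).1.component := by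
  obtain ⟨n, hkn, hn⟩ := (Filter.frequently_atTop.1 hacc) k
  obtain ⟨d, rfl⟩ := Nat.exists_eq_add_of_le hkn
  clear hkn
  induction d generalizing k with
  | zero => exact ⟨k, le_rfl, hn, rfl⟩
  | succ d ih =>
    by_cases hk : ρ k ∈ A65.F
    · exact ⟨k, le_rfl, hk, rfl⟩
    · obtain ⟨m, h₁, h₂, h₃⟩ := ih (k + 1) (by rwa [show k + 1 + d = k + (d + 1) by omega])
      refine ⟨m, by omega, h₂, h₃.trans ?_⟩
      rw [← (hρ.2 k).2.2]
      exact ((hρ.2 k).1.resolve_right hk).component_eq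

theorem exists_Y_y (hρ : A65.IsRun q w ρ) (hacc : A65.Accepting ρ) (k : ℕ) :
    ∃ m, k ≤ m ∧ (ρ m).1 = .Y ∧ w m = .y ∧ (ρ (m + 1)).1 = .I := by
  have next : ∀ k, ∃ m, k ≤ m ∧ (ρ m).1.component = (ρ k).1.component + 1 := by
    intro k
    obtain ⟨m, h₁, h₂, h₃⟩ := exists_sig_same_component hρ hacc k
    refine ⟨m + 1, by omega, ?_⟩
    rw [← (hρ.2 m).2.2, Sig.component_eq h₂, h₃]
  have two : ∃ m, k ≤ m ∧ (ρ m).1.component = 2 := by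
    obtain ⟨m₁, h₁, e₁⟩ := next k
    obtain ⟨m₂, h₂, e₂⟩ := next m₁
    -- At most two changes of component lead to `Y`.
    have : ∀ c : Fin 3, c = 2 ∨ c + 1 = 2 ∨ c + 1 + 1 = 2 := by decide
    rcases this (ρ k).1.component with h | h | h
    · exact ⟨k, le_rfl, h⟩
    · exact ⟨m₁, h₁, e₁.trans h⟩
    · exact ⟨m₂, h₁.trans h₂, by rw [e₂, e₁, h]⟩
  obtain ⟨m, hm, e⟩ := two
  obtain ⟨n, h₁, h₂, h₃⟩ := exists_sig_same_component hρ hacc m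
  obtain ⟨f₁, f₂, f₃⟩ := Sig.of_component_eq_two h₂ (h₃.trans e)
  exact ⟨n, hm.trans h₁, f₁, (hρ.2 n).2.1 ▸ f₂, (hρ.2 n).2.2 ▸ f₃⟩

theorem witness_of_run (hρ : A65.IsRun q w ρ) {k : ℕ} (hk : (ρ k).1 = .I) (d : ℕ) :
    Witness ((List.range' k d).map w) (ρ (k + d)).1 := by
  induction d with
  | zero => rw [Nat.add_zero, hk]; trivial
  | succ d ih =>
    rw [List.range'_1_concat, List.map_append, List.map_singleton, ← Nat.add_assoc,
      ← (hρ.2 (k + d)).2.2, ← (hρ.2 (k + d)).2.1]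
    rcases (hρ.2 (k + d)).1 with h | h
    · exact ih.step_nonSig h
    · exact ih.step_sig h

theorem langFrom_subset (q : State) : A65.langFrom q ⊆ L65 := by
  rintro w ⟨ρ, hρ, hacc⟩
  refine mem_omegaPower_of_forall fun k => ?_
  obtain ⟨m, hm, -, -, hI⟩ := exists_Y_y hρ hacc k
  obtain ⟨n, hn, hY, hy, -⟩ := exists_Y_y hρ hacc (m + 1)
  obtain ⟨d, rfl⟩ := Nat.exists_eq_add_of_le hn
  have hw := witness_of_run hρ hI d
  rw [hY] at hw
  obtain ⟨i, j, hij, u₀, v, u₁, hu, hv⟩ := hw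
  -- The stretch from `k` to the arrival in `I` is absorbed by the leading Σ*; the cut comes just
  -- after the `y` read at position `m + 1 + d`.
  refine ⟨m + 1 + d + 1, by omega, i, j, hij, (List.range' k (m + 1 - k)).map w ++ u₀, v, u₁, hv, ?_⟩
  have e : List.range' k (m + 1 + d + 1 - k) =
      List.range' k (m + 1 - k) ++ List.range' (m + 1) d ++ [m + 1 + d] := by
    rw [show m + 1 + d + 1 - k = m + 1 - k + d + 1 by omega, List.range'_1_concat,
      ← List.range'_append_1, show k + (m + 1 - k) = m + 1 by omega,
      show k + (m + 1 - k + d) = m + 1 + d by omega]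
  rw [e, List.map_append, List.map_append, hu, List.map_singleton, hy]
  simp

end Soundness

/-! ### The tracker and the resolved automaton -/

instance (q : State) : Decidable q.IsTop := by unfold State.IsTop; infer_instance

instance (q : State) (i : Fin 6) : Decidable (q.TopAdvances i) := by
  unfold State.TopAdvances; infer_instance

/-- The transitions of `A65` after the nondeterminism has been resolved: `g` tells whether the next
advance is expected to be on a letter of `F`. -/
def stepTo (g : Bool) : State → Letter → State
  | .Y, .y => .I
  | .Y, _ => .Y
  | .I, .a | .Ic, .a => if g then .Ia else .I
  | .I, .b | .Ic, .b => .I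
  | .I, .c | .Ic, .c => .Ic
  | .Ia, .a | .Ia, .c | .Ib, .a | .Ib, .c => .Ia
  | .Ia, .b | .Ib, .b => .Ib
  | .circ x i, .num j => if x.advances j then if j = i then .circ .p i else .sqr .p j
      else .circ .p i
  | .sqr x i, .num j => if x.advances j then if j = i then .Y else .sqr .p j else .sqr .p i
  | _, .reset j => .circ .p j
  | .circ x i, l => .circ ((x.next l).getD .p) i
  | .sqr x i, l => .sqr ((x.next l).getD .p) i
  | q, .num i => if q.TopAdvances i then .circ .p i else .I
  | _, .y => .I

theorem Pos.next_num (x : Pos) (j : Fin 6) :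
    x.next (.num j) = if x.advances j then none else some .p := by
  cases x <;> rfl

theorem Pos.next_num_eq_some {x x' : Pos} {j : Fin 6} :
    x.next (.num j) = some x' ↔ ¬ x.advances j ∧ x' = .p := by
  rw [Pos.next_num]
  split_ifs with h <;> simp [h, eq_comm]

theorem stepTo_circ_next {x x' : Pos} {l : Letter} (h : x.next l = some x') (g : Bool)
    (i : Fin 6) : stepTo g (.circ x i) l = .circ x' i := by
  cases l with
  | num j =>
    obtain ⟨h', rfl⟩ := Pos.next_num_eq_some.1 h
    simp [stepTo, h']
  | reset j => cases x <;> cases h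
  | _ => simp [stepTo, h]

theorem stepTo_sqr_next {x x' : Pos} {l : Letter} (h : x.next l = some x') (g : Bool)
    (i : Fin 6) : stepTo g (.sqr x i) l = .sqr x' i := by
  cases l with
  | num j =>
    obtain ⟨h', rfl⟩ := Pos.next_num_eq_some.1 h
    simp [stepTo, h']
  | reset j => cases x <;> cases h
  | _ => simp [stepTo, h]

/-- The only nondeterminism is the choice on `a` in the top component, so elsewhere the bit `g` is
irrelevant. -/
theorem NonSig.eq_stepTo {q q' : State} {l : Letter} (h : NonSig q l q') (hq : ¬ q.IsTop)
    (g : Bool) : q' = stepTo g q l := by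
  cases h with
  | top_y _ h | top_num _ _ h => exact absurd h hq
  | circ_next x x' i l h => rw [stepTo_circ_next h]
  | sqr_next x x' i l h => rw [stepTo_sqr_next h]
  | circ_same x i h => simp [stepTo, h]
  | circ_other x i j h hij => simp [stepTo, h, hij]
  | sqr_other x i j h hij => simp [stepTo, h, hij]
  | circ_reset | sqr_reset => rfl
  | Y_loop l hl => cases l <;> first | rfl | exact absurd rfl hl
  | _ => simp [State.IsTop] at hq

theorem Sig.eq_stepTo {q q' : State} {l : Letter} (h : Sig q l q') (g : Bool) :
    q' = stepTo g q l := by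
  cases h with
  | top_num q i h =>
    have h' := h
    rcases h with ⟨-, rfl⟩ | ⟨-, rfl⟩ <;> simp [stepTo, h']
  | top_reset q i h => rcases h with rfl | rfl | rfl | rfl <;> rfl
  | sqr_same x i h => simp [stepTo, h]
  | Y_y => rfl

theorem NonSig.not_sig {q q' : State} {l : Letter} (h : NonSig q l q') : ¬ Sig q l q' := fun h' => by
  have := h.component_eq.symm.trans h'.component_eq
  generalize q.component = c at this
  revert c; decide

theorem stepTo_top_y (g : Bool) {q : State} (h : q.IsTop) : stepTo g q .y = .I := by
  rcases h with rfl | rfl | rfl | rfl <;> rfl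

theorem stepTo_top_num (g : Bool) {q : State} (h : q.IsTop) (i : Fin 6) :
    stepTo g q (.num i) = if q.TopAdvances i then .circ .p i else .I := by
  rcases h with rfl | rfl | rfl | rfl <;> rfl

theorem stepTo_top_reset (g : Bool) {q : State} (h : q.IsTop) (i : Fin 6) :
    stepTo g q (.reset i) = .circ .p i := by
  rcases h with rfl | rfl | rfl | rfl <;> rfl

theorem Pos.exists_next {x : Pos} {l : Letter} (h : ∀ j, l ≠ .reset j)
    (h' : ∀ j, l = .num j → ¬ x.advances j) : ∃ x', x.next l = some x' := by
  cases l with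
  | num j => exact ⟨.p, Pos.next_num_eq_some.2 ⟨h' j rfl, rfl⟩⟩
  | reset j => exact absurd rfl (h j)
  | _ => cases x <;> exact ⟨_, rfl⟩

/-- Reset, advance or inner move: the case distinction behind every step argument below. -/
theorem Pos.letter_cases (x : Pos) (l : Letter) :
    (∃ j, l = .reset j) ∨ (∃ j, l = .num j ∧ x.advances j) ∨ ∃ x', x.next l = some x' := by
  by_cases h : ∃ j, l = .reset j
  · exact .inl h
  by_cases h' : ∃ j, l = .num j ∧ x.advances j
  · exact .inr (.inl h')
  · push Not at h h'
    exact .inr (.inr (Pos.exists_next h h'))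

theorem stepTo_mem (g : Bool) (q : State) (l : Letter) :
    NonSig q l (stepTo g q l) ∨ Sig q l (stepTo g q l) := by
  by_cases hq : q.IsTop
  · cases l with
    | y => rw [stepTo_top_y g hq]; exact .inl (.top_y _ hq)
    | num i =>
      rw [stepTo_top_num g hq]
      split_ifs with h
      · exact .inr (.top_num _ _ h)
      · exact .inl (.top_num _ _ hq h)
    | reset i => rw [stepTo_top_reset g hq]; exact .inr (.top_reset _ _ hq)
    | _ =>
      refine .inl ?_
      cases g <;> rcases hq with rfl | rfl | rfl | rfl <;> constructor
  · cases q with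
    | circ x i =>
      rcases x.letter_cases l with ⟨j, rfl⟩ | ⟨j, rfl, h⟩ | ⟨x', h⟩
      · exact .inl (.circ_reset _ _ _)
      · by_cases hij : j = i
        · subst hij
          simpa [stepTo, h] using Or.inl (NonSig.circ_same x j h)
        · simpa [stepTo, h, hij] using Or.inl (NonSig.circ_other x i j h hij)
      · rw [stepTo_circ_next h]
        exact .inl (.circ_next _ _ _ _ h)
    | sqr x i =>
      rcases x.letter_cases l with ⟨j, rfl⟩ | ⟨j, rfl, h⟩ | ⟨x', h⟩
      · exact .inl (.sqr_reset _ _ _)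
      · by_cases hij : j = i
        · subst hij
          simpa [stepTo, h] using Or.inr (Sig.sqr_same x j h)
        · simpa [stepTo, h, hij] using Or.inl (NonSig.sqr_other x i j h hij)
      · rw [stepTo_sqr_next h]
        exact .inl (.sqr_next _ _ _ _ h)
    | Y =>
      by_cases hl : l = .y
      · subst hl; exact .inr .Y_y
      · have : stepTo g .Y l = .Y := by cases l <;> first | rfl | exact absurd rfl hl
        rw [this]
        exact .inl (.Y_loop l hl)
    | _ => simp [State.IsTop] at hq

/-- The tracker stores the position of a block that never leaves its block, and whether the last
advance was on a letter of `F`. -/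
abbrev Tracker := Pos × Bool

/-- The transitions of the tracker. -/
def trackerStep (t : Tracker) (l : Letter) : Tracker :=
  ((t.1.next l).getD .p,
    match l with
    | .num i => if t.1.advances i then decide (3 ≤ i.val) else t.2
    | _ => t.2)

theorem trackerStep_next {x x' : Pos} {l : Letter} (h : x.next l = some x') (g : Bool) :
    trackerStep (x, g) l = (x', g) := by
  cases l with
  | num j =>
    obtain ⟨h', rfl⟩ := Pos.next_num_eq_some.1 h
    simp [trackerStep, Pos.next_num, h']
  | _ => simp [trackerStep, h]

theorem trackerStep_num {x : Pos} {i : Fin 6} (h : x.advances i) (g : Bool) :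
    trackerStep (x, g) (.num i) = (.p, decide (3 ≤ i.val)) := by
  simp [trackerStep, Pos.next_num, h]

theorem trackerStep_reset (x : Pos) (i : Fin 6) (g : Bool) :
    trackerStep (x, g) (.reset i) = (.p, g) := by
  cases x <;> rfl

/-- The state of the top component that matches a state of the tracker. -/
def topState : Tracker → State
  | (.p, _) => .I
  | (.t, _) => .Ic
  | (.q, false) | (.r, false) => .I
  | (.s, false) => .Ic
  | (.q, true) | (.s, true) => .Ia
  | (.r, true) => .Ib

/-- A state of `A65` is in step with the tracker. -/
def InStep (t : Tracker) : State → Prop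
  | .circ x _ | .sqr x _ => x = t.1
  | .Y => True
  | q => q = topState t

theorem topState_isTop (t : Tracker) : (topState t).IsTop := by
  rcases t with ⟨x, g⟩
  cases x <;> cases g <;> simp [topState, State.IsTop]

theorem inStep_topState (t : Tracker) : InStep t (topState t) := by
  rcases t with ⟨x, g⟩
  cases x <;> cases g <;> rfl

theorem inStep_iff_of_isTop {t : Tracker} {q : State} (h : q.IsTop) :
    InStep t q ↔ q = topState t := by
  rcases h with rfl | rfl | rfl | rfl <;> rfl

/-- With a correct guess `g` the top advances whenever the block does. The extra case is `Ic`, which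
stands for `t` under either guess and so advances on `E` even if `F` was expected. -/
theorem topAdvances_topState {x : Pos} {g : Bool} {i : Fin 6} :
    (topState (x, g)).TopAdvances i ↔ x.advances i ∧ g = decide (3 ≤ i.val) ∨
      x = .t ∧ i.val < 3 := by
  revert x g i; decide

/-- For a fixed guess the top component is a quotient of the block; this is what makes the tracker's
bit sufficient to resolve the choice on `a`. -/
theorem topState_step {x : Pos} {g : Bool} {l : Letter} {x' : Pos} (h : x.next l = some x') :
    stepTo g (topState (x, g)) l = topState (x', g) := by
  revert x g l x'; decide

theorem InStep.step {t : Tracker} {q : State} (h : InStep t q) (l : Letter) :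
    InStep (trackerStep t l) (stepTo t.2 q l) := by
  obtain ⟨x, g⟩ := t
  by_cases hq : q.IsTop
  · obtain rfl := (inStep_iff_of_isTop hq).1 h
    rcases x.letter_cases l with ⟨j, rfl⟩ | ⟨j, rfl, h⟩ | ⟨x', h⟩
    · rw [stepTo_top_reset _ hq, trackerStep_reset]; rfl
    · rw [stepTo_top_num _ hq, trackerStep_num h]
      split_ifs <;> rfl
    · rw [trackerStep_next h, topState_step h]
      exact inStep_topState _
  · cases q with
    | circ z i =>
      obtain rfl : z = x := h
      rcases z.letter_cases l with ⟨j, rfl⟩ | ⟨j, rfl, h⟩ | ⟨x', h⟩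
      · rw [trackerStep_reset]; rfl
      · rw [trackerStep_num h]
        simp only [stepTo, h, if_true]
        split_ifs <;> rfl
      · rw [trackerStep_next h, stepTo_circ_next h]; rfl
    | sqr z i =>
      obtain rfl : z = x := h
      rcases z.letter_cases l with ⟨j, rfl⟩ | ⟨j, rfl, h⟩ | ⟨x', h⟩
      · rw [trackerStep_reset]; rfl
      · rw [trackerStep_num h]
        simp only [stepTo, h, if_true]
        split_ifs <;> trivial
      · rw [trackerStep_next h, stepTo_sqr_next h]; rfl
    | Y =>
      by_cases hl : l = .y
      · subst hl; cases x <;> rfl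
      · have : stepTo g .Y l = .Y := by cases l <;> first | rfl | exact absurd rfl hl
        rw [this]; trivial
    | _ => simp [State.IsTop] at hq

/-- Lets the completeness argument start in any state, not just in `I`. -/
theorem exists_inStep (q : State) : ∃ t, InStep t q := by
  cases q with
  | I => exact ⟨(.p, false), rfl⟩
  | Ia => exact ⟨(.q, true), rfl⟩
  | Ib => exact ⟨(.r, true), rfl⟩
  | Ic => exact ⟨(.t, false), rfl⟩
  | circ x _ => exact ⟨(x, false), rfl⟩
  | sqr x _ => exact ⟨(x, false), rfl⟩
  | Y => exact ⟨(.p, false), trivial⟩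

/-! ### Completeness -/

/-- A joint step of the tracker and of the automaton that it resolves. -/
def jointStep (c : Tracker × State) (l : Letter) : Tracker × State :=
  (trackerStep c.1 l, stepTo c.1.2 c.2 l)

/-- The word is read from `c` without a significant transition. -/
def Quiet : Tracker × State → List Letter → Prop
  | _, [] => True
  | c, l :: u => ¬ Sig c.2 l (stepTo c.1.2 c.2 l) ∧ Quiet (jointStep c l) u

theorem quiet_append (c : Tracker × State) (u v : List Letter) :
    Quiet c (u ++ v) ↔ Quiet c u ∧ Quiet (u.foldl jointStep c) v := by
  induction u generalizing c with
  | nil => simp [Quiet]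
  | cons l u ih => simp [Quiet, ih, and_assoc]

theorem quiet_singleton (c : Tracker × State) (l : Letter) :
    Quiet c [l] ↔ ¬ Sig c.2 l (stepTo c.1.2 c.2 l) := by
  simp [Quiet]

theorem component_foldl_of_quiet {c : Tracker × State} {u : List Letter} (h : Quiet c u) :
    (u.foldl jointStep c).2.component = c.2.component := by
  induction u generalizing c with
  | nil => rfl
  | cons l u ih =>
    exact (ih h.2).trans ((stepTo_mem c.1.2 c.2 l).resolve_right h.1).component_eq

theorem inStep_foldl {c : Tracker × State} (h : InStep c.1 c.2) (u : List Letter) :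
    InStep (u.foldl jointStep c).1 (u.foldl jointStep c).2 := by
  induction u generalizing c with
  | nil => exact h
  | cons l u ih => exact ih (h.step l)

theorem not_quiet_Y {t : Tracker} {u : List Letter} (hu : .y ∈ u) : ¬ Quiet (t, .Y) u := by
  induction u generalizing t with
  | nil => cases hu
  | cons l u ih =>
    rintro ⟨h₁, h₂⟩
    by_cases hl : l = .y
    · subst hl
      exact h₁ .Y_y
    · have hu : .y ∈ u := (List.mem_cons.1 hu).resolve_left (Ne.symm hl)
      have : jointStep (t, .Y) l = (trackerStep t l, .Y) := by
        cases l <;> first | rfl | exact absurd rfl hl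
      rw [this] at h₂
      exact ih hu h₂

theorem foldl_circ {x x' : Pos} {u : List Letter} (h : x.run u = some x') (g : Bool) (i : Fin 6) :
    u.foldl jointStep ((x, g), .circ x i) = ((x', g), .circ x' i) := by
  induction u generalizing x with
  | nil => cases h; rfl
  | cons l u ih =>
    obtain ⟨z, h₁, h₂⟩ := (Pos.run_cons _ _ _ _).1 h
    rw [List.foldl_cons, jointStep, trackerStep_next h₁, stepTo_circ_next h₁, ih h₂]

theorem foldl_sqr {x x' : Pos} {u : List Letter} (h : x.run u = some x') (g : Bool) (i : Fin 6) :
    u.foldl jointStep ((x, g), .sqr x i) = ((x', g), .sqr x' i) := by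
  induction u generalizing x with
  | nil => cases h; rfl
  | cons l u ih =>
    obtain ⟨z, h₁, h₂⟩ := (Pos.run_cons _ _ _ _).1 h
    rw [List.foldl_cons, jointStep, trackerStep_next h₁, stepTo_sqr_next h₁, ih h₂]

theorem foldl_topState {x x' : Pos} {u : List Letter} (h : x.run u = some x') (g : Bool) :
    u.foldl jointStep ((x, g), topState (x, g)) = ((x', g), topState (x', g)) := by
  induction u generalizing x with
  | nil => cases h; rfl
  | cons l u ih =>
    obtain ⟨z, h₁, h₂⟩ := (Pos.run_cons _ _ _ _).1 h
    rw [List.foldl_cons, jointStep, trackerStep_next h₁, topState_step h₁, ih h₂]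

/-- A reading that starts from `z` may be shadowed by a tracker in position `x`, which saw a longer
part of the word. -/
def Shadows (z x : Pos) : Prop := z = x ∨ z = .p ∨ z = .t ∧ x = .s

instance (z x : Pos) : Decidable (Shadows z x) := by unfold Shadows; infer_instance

theorem Shadows.advances {z x : Pos} (h : Shadows z x) {i : Fin 6} (hz : z.advances i) :
    x.advances i := by
  revert z x i; decide

/-- If the tracker advances where the shorter reading does not, both land in `p`. Together with
`Shadows.advances`, this makes the tracker advance at the end of every factor in `blockLang i`,
wherever it was at the start. -/
theorem Shadows.next {z z' x : Pos} (h : Shadows z x) {l : Letter} (hz : z.next l = some z') :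
    Shadows z' ((x.next l).getD .p) := by
  revert z z' x l; decide

theorem Shadows.foldl {z z' : Pos} {c : Tracker × State} (h : Shadows z c.1.1) {u : List Letter}
    (hz : z.run u = some z') : Shadows z' (u.foldl jointStep c).1.1 := by
  induction u generalizing z c with
  | nil => cases hz; exact h
  | cons l u ih =>
    obtain ⟨y, h₁, h₂⟩ := (Pos.run_cons _ _ _ _).1 hz
    exact ih (h.next h₁) h₂

/-- The situation after an advance on `i` that is not significant. -/
theorem jointStep_num {c : Tracker × State} (hc : InStep c.1 c.2) {i : Fin 6}
    (hi : c.1.1.advances i) (hq : Quiet c [.num i]) :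
    (jointStep c (.num i)).1 = (.p, decide (3 ≤ i.val)) ∧
      ((jointStep c (.num i)).2 = .Y ∨ (jointStep c (.num i)).2 = .I ∨
        (jointStep c (.num i)).2 = .circ .p i ∨ (jointStep c (.num i)).2 = .sqr .p i) := by
  obtain ⟨⟨x, g⟩, q⟩ := c
  rw [quiet_singleton] at hq
  refine ⟨trackerStep_num hi g, ?_⟩
  simp only [jointStep] at hq ⊢
  by_cases ht : q.IsTop
  · rw [stepTo_top_num _ ht] at hq ⊢
    split_ifs with h
    · exact .inr (.inr (.inl rfl))
    · exact .inr (.inl rfl)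
  · cases q with
    | circ z j =>
      obtain rfl : z = x := hc
      have hi' : z.advances i := hi
      simp only [stepTo, hi', if_true]
      split_ifs with h <;> simp [h]
    | sqr z j =>
      obtain rfl : z = x := hc
      have hi' : z.advances i := hi
      simp only [stepTo, hi', if_true]
      split_ifs with h <;> simp
    | Y => exact .inl rfl
    | _ => simp [State.IsTop] at ht

/-- The situation after a quiet reading of a word of `blockLang i`. -/
theorem quiet_blockLang {c : Tracker × State} (hc : InStep c.1 c.2) {i : Fin 6} {v : List Letter}
    (hv : v ∈ blockLang i) (hq : Quiet c v) :
    (v.foldl jointStep c).1 = (.p, decide (3 ≤ i.val)) ∧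
      ((v.foldl jointStep c).2 = .Y ∨ (v.foldl jointStep c).2 = .I ∨
        (v.foldl jointStep c).2 = .circ .p i ∨ (v.foldl jointStep c).2 = .sqr .p i) := by
  obtain ⟨u, x, rfl, hu, hx⟩ := (mem_blockLang _ _).1 hv
  have hs : Shadows x (u.foldl jointStep c).1.1 :=
    Shadows.foldl (.inr (.inl rfl)) hu
  rw [List.foldl_append]
  exact jointStep_num (inStep_foldl hc u) (hs.advances hx) ((quiet_append _ _ _).1 hq).2

/-- A reset leaves the tracker's bit unchanged, so only its position is known afterwards; the bit is
fixed by the following factor. -/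
theorem quiet_blockLang_add_reset {c : Tracker × State} (hc : InStep c.1 c.2) {i : Fin 6}
    {v : List Letter} (hv : v ∈ blockLang i + ({[Letter.reset i]} : Language Letter))
    (hq : Quiet c v) :
    (v.foldl jointStep c).1.1 = .p ∧
      ((v.foldl jointStep c).2 = .Y ∨ (v.foldl jointStep c).2 = .I ∨
        (v.foldl jointStep c).2 = .circ .p i ∨ (v.foldl jointStep c).2 = .sqr .p i) := by
  rcases (Language.mem_add _ _ _).1 hv with hv | rfl
  · obtain ⟨h₁, h₂⟩ := quiet_blockLang hc hv hq
    exact ⟨by rw [h₁], h₂⟩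
  · obtain ⟨⟨x, g⟩, q⟩ := c
    rw [quiet_singleton] at hq
    simp only [List.foldl_cons, List.foldl_nil, jointStep, trackerStep_reset]
    refine ⟨trivial, ?_⟩
    by_cases ht : q.IsTop
    · rw [stepTo_top_reset _ ht]; exact .inr (.inr (.inl rfl))
    · cases q with
      | circ z j => exact .inr (.inr (.inl rfl))
      | sqr z j => exact .inr (.inr (.inl rfl))
      | Y => exact .inl rfl
      | _ => simp [State.IsTop] at ht

theorem foldl_blockLang_of_block {t : Tracker} (ht : t.1 = .p) {i j : Fin 6} (hij : i ≠ j)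
    {v : List Letter} (hv : v ∈ blockLang j) {q : State} (hq : q = .circ .p i ∨ q = .sqr .p i) :
    (v.foldl jointStep (t, q)).2 = .sqr .p j := by
  obtain ⟨u, x, rfl, hu, hx⟩ := (mem_blockLang _ _).1 hv
  obtain ⟨z, g⟩ := t
  obtain rfl : z = .p := ht
  rcases hq with rfl | rfl
  · simp [List.foldl_append, foldl_circ hu, jointStep, stepTo, hx, hij.symm]
  · simp [List.foldl_append, foldl_sqr hu, jointStep, stepTo, hx, hij.symm]

theorem not_quiet_blockLang_of_sqr {t : Tracker} (ht : t.1 = .p) {j : Fin 6} {v : List Letter}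
    (hv : v ∈ blockLang j) : ¬ Quiet (t, .sqr .p j) v := by
  obtain ⟨u, x, rfl, hu, hx⟩ := (mem_blockLang _ _).1 hv
  obtain ⟨z, g⟩ := t
  obtain rfl : z = .p := ht
  rw [quiet_append, foldl_sqr hu, quiet_singleton]
  have h := Sig.sqr_same x j hx
  rw [h.eq_stepTo g] at h
  exact fun h' => h'.2 h

/-- The bit is the kind of `j`, so the guess is right: the top follows the block up to the advance,
which is then significant. -/
theorem not_quiet_blockLang_of_top {j : Fin 6} {v : List Letter} (hv : v ∈ blockLang j) :
    ¬ Quiet ((.p, decide (3 ≤ j.val)), .I) v := by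
  obtain ⟨u, x, rfl, hu, hx⟩ := (mem_blockLang _ _).1 hv
  have e := foldl_topState hu (decide (3 ≤ j.val))
  rw [quiet_append, show State.I = topState (.p, decide (3 ≤ j.val)) from rfl, e, quiet_singleton]
  have h := Sig.top_num _ j (topAdvances_topState.2 (.inl ⟨hx, rfl⟩))
  rw [h.eq_stepTo (decide (3 ≤ j.val))] at h
  exact fun h' => h'.2 h

/-- A significant transition is taken on every word of `factorLang`. -/
theorem not_quiet_factorLang {c : Tracker × State} (hc : InStep c.1 c.2) {u : List Letter}
    (hu : u ∈ factorLang) : ¬ Quiet c u := by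
  obtain ⟨i, j, hij, x, v, z, hv, rfl⟩ := hu
  obtain ⟨v', hv', v₃, hv₃, rfl⟩ := Language.mem_mul.1 hv
  obtain ⟨v₁, hv₁, v₂, hv₂, rfl⟩ := Language.mem_mul.1 hv'
  intro hq
  simp only [List.append_assoc] at hq
  obtain ⟨-, hq⟩ := (quiet_append _ _ _).1 hq
  have hc₀ := inStep_foldl hc x
  generalize x.foldl jointStep c = c₀ at hc₀ hq
  obtain ⟨q₁, hq⟩ := (quiet_append _ _ _).1 hq
  obtain ⟨e₁, s₁⟩ := quiet_blockLang_add_reset hc₀ hv₁ q₁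
  have hc₁ := inStep_foldl hc₀ v₁
  generalize v₁.foldl jointStep c₀ = c₁ at e₁ s₁ hc₁ hq
  obtain ⟨t₁, r₁⟩ := c₁
  obtain ⟨q₂, hq₂⟩ := (quiet_append _ _ _).1 hq
  obtain ⟨e₂, s₂⟩ := quiet_blockLang hc₁ hv₂ q₂
  have hb := foldl_blockLang_of_block e₁ hij hv₂ (q := r₁)
  have ht := component_foldl_of_quiet q₂
  generalize v₂.foldl jointStep (t₁, r₁) = c₂ at e₂ s₂ hb ht hq₂
  obtain ⟨t₂, r₂⟩ := c₂
  obtain rfl : t₂ = (.p, decide (3 ≤ j.val)) := e₂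
  have hsqr : r₂ ≠ .sqr .p j := by
    rintro rfl
    exact not_quiet_blockLang_of_sqr rfl hv₃ ((quiet_append _ _ _).1 hq₂).1
  have htop : r₂ ≠ .I := by
    rintro rfl
    exact not_quiet_blockLang_of_top hv₃ ((quiet_append _ _ _).1 hq₂).1
  -- The cases are the state after v₁: `Y`, `I`, or a block of index `i`. In the second, v₂ is quiet
  -- and stays in the top component, which excludes `Y` and the circular block after it.
  rcases s₁ with h | h | h
  · obtain rfl : r₁ = .Y := h
    exact not_quiet_Y (by simp) hq
  · obtain rfl : r₁ = .I := h
    rcases s₂ with h | h | h | h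
    · obtain rfl : r₂ = .Y := h
      cases ht
    · exact htop h
    · obtain rfl : r₂ = .circ .p j := h
      cases ht
    · exact hsqr h
  · exact hsqr (hb h)

/-! ### The resolved run -/

/-- The joint run on `w` of the tracker and the automaton that it resolves. -/
def jointRun (c : Tracker × State) (w : ℕ → Letter) (n : ℕ) : Tracker × State :=
  ((List.range n).map w).foldl jointStep c

theorem jointRun_succ (c : Tracker × State) (w : ℕ → Letter) (n : ℕ) :
    jointRun c w (n + 1) = jointStep (jointRun c w n) (w n) := by
  simp [jointRun, List.range_succ]

/-- The transitions of `A65` along the joint run. -/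
def resolvedRun (c : Tracker × State) (w : ℕ → Letter) (n : ℕ) : State × Letter × State :=
  ((jointRun c w n).2, w n, (jointRun c w (n + 1)).2)

theorem isRun_resolvedRun (c : Tracker × State) (w : ℕ → Letter) :
    A65.IsRun c.2 w (resolvedRun c w) := by
  refine ⟨rfl, fun n => ⟨?_, rfl, rfl⟩⟩
  rw [resolvedRun, jointRun_succ]
  exact stepTo_mem _ _ _

theorem quiet_range' {c : Tracker × State} {w : ℕ → Letter} {N : ℕ}
    (h : ∀ n, N ≤ n → resolvedRun c w n ∉ A65.F) (k n : ℕ) (hn : N ≤ n) :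
    Quiet (jointRun c w n) ((List.range' n k).map w) := by
  induction k generalizing n with
  | zero => trivial
  | succ k ih =>
    refine ⟨fun hs => h n hn ?_, ?_⟩
    · rw [resolvedRun, jointRun_succ]
      exact hs
    · rw [← jointRun_succ]
      exact ih _ (by omega)

/-- If nothing significant occurred from `N` on, the factor starting at `t N ≥ N` would be read
quietly, against `not_quiet_factorLang`. -/
theorem accepting_resolvedRun {c : Tracker × State} (hc : InStep c.1 c.2) {w : ℕ → Letter}
    (hw : w ∈ L65) : A65.Accepting (resolvedRun c w) := by
  obtain ⟨t, -, ht, hf⟩ := hw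
  by_contra hacc
  rw [BuchiAutomaton.Accepting, Filter.not_frequently, Filter.eventually_atTop] at hacc
  obtain ⟨N, hN⟩ := hacc
  exact not_quiet_factorLang (inStep_foldl hc _) (hf N) (quiet_range' hN _ _ (ht.id_le N))

theorem langFrom_eq (q : State) : A65.langFrom q = L65 := by
  refine (langFrom_subset q).antisymm fun w hw => ?_
  obtain ⟨t, ht⟩ := exists_inStep q
  exact ⟨_, isRun_resolvedRun (t, q) w, accepting_resolvedRun ht hw⟩

/-- The resolver that reads the expected kind of the next advance off the tracker. -/
def resolver (h : List (State × Letter × State)) (l : Letter) : State × Letter × State :=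
  let q := (h.getLast?.map (fun e => e.2.2)).getD .I
  let t := (h.map (fun e => e.2.1)).foldl trackerStep (.p, false)
  (q, l, stepTo t.2 q l)

theorem isResolver_resolver : A65.IsResolver resolver := by
  intro l q _ h _
  refine ⟨stepTo_mem _ _ _, ?_, rfl⟩
  rcases List.eq_nil_or_concat l with rfl | ⟨l, e, rfl⟩
  · exact h
  · rw [List.concat_eq_append] at h ⊢
    simpa [resolver] using ((BuchiAutomaton.isPath_concat _ _ _ _ _).1 h).2.2

theorem inducedRun_resolver (w : ℕ → Letter) :
    BuchiAutomaton.inducedRun resolver w = resolvedRun ((.p, false), .I) w := by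
  have key : ∀ n,
      ((BuchiAutomaton.inducedPrefix resolver w n).map (fun e => e.2.1)).foldl trackerStep
        (.p, false) = (jointRun ((.p, false), .I) w n).1 ∧
      ((BuchiAutomaton.inducedPrefix resolver w n).getLast?.map (fun e => e.2.2)).getD .I =
        (jointRun ((.p, false), .I) w n).2 := by
    intro n
    induction n with
    | zero => exact ⟨rfl, rfl⟩
    | succ n ih =>
      rw [jointRun_succ, jointStep, ← ih.1, ← ih.2]
      simp [BuchiAutomaton.inducedPrefix, resolver]
  funext n
  rw [BuchiAutomaton.inducedRun, resolver, resolvedRun, jointRun_succ, jointStep, (key n).1,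
    (key n).2]

theorem isHistoryDeterministic_A65 : A65.IsHistoryDeterministic := by
  refine ⟨resolver, isResolver_resolver, fun w hw => ?_⟩
  rw [inducedRun_resolver]
  exact ⟨isRun_resolvedRun _ w, accepting_resolvedRun (c := ((.p, false), .I)) rfl (langFrom_eq .I ▸ hw)⟩

/-! ### Normality -/

theorem nonSigEdge {q q' : State} {l : Letter} (h : NonSig q l q') : A65.NonSigEdge q q' :=
  ⟨l, .inl h, h.not_sig⟩

theorem reflTransGen_circ (x x' : Pos) (i : Fin 6) :
    Relation.ReflTransGen A65.NonSigEdge (.circ x i) (.circ x' i) := by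
  have next : ∀ z z' l, Pos.next z l = some z' →
      Relation.ReflTransGen A65.NonSigEdge (.circ z i) (.circ z' i) :=
    fun z z' l h => .single (nonSigEdge (.circ_next _ _ _ l h))
  have hq := next x .q .a (by cases x <;> rfl)
  have hp := next x .p .y (by cases x <;> rfl)
  cases x' with
  | p => exact hp
  | q => exact hq
  | r => exact hq.trans (next _ _ .b rfl)
  | s => exact hq.trans (next _ _ .c rfl)
  | t => exact hp.trans (next _ _ .c rfl)

theorem reflTransGen_sqr (x x' : Pos) (i : Fin 6) :
    Relation.ReflTransGen A65.NonSigEdge (.sqr x i) (.sqr x' i) := by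
  have next : ∀ z z' l, Pos.next z l = some z' →
      Relation.ReflTransGen A65.NonSigEdge (.sqr z i) (.sqr z' i) :=
    fun z z' l h => .single (nonSigEdge (.sqr_next _ _ _ l h))
  have hq := next x .q .a (by cases x <;> rfl)
  have hp := next x .p .y (by cases x <;> rfl)
  cases x' with
  | p => exact hp
  | q => exact hq
  | r => exact hq.trans (next _ _ .b rfl)
  | s => exact hq.trans (next _ _ .c rfl)
  | t => exact hp.trans (next _ _ .c rfl)

theorem exists_advances (i : Fin 6) : ∃ x : Pos, x.advances i := by
  revert i; decide

theorem reflTransGen_of_top {q q' : State} (h : q.IsTop) (h' : q'.IsTop) :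
    Relation.ReflTransGen A65.NonSigEdge q q' := by
  have hI : Relation.ReflTransGen A65.NonSigEdge q .I := .single (nonSigEdge (.top_y _ h))
  have ha : Relation.ReflTransGen A65.NonSigEdge q .Ia := hI.tail (nonSigEdge .I_a')
  rcases h' with rfl | rfl | rfl | rfl
  · exact hI
  · exact ha
  · exact ha.tail (nonSigEdge .Ia_b)
  · exact hI.tail (nonSigEdge .I_c)

/-- Resets lead to every circular block; the square block of `i` is entered by an advance on `i`
from a circular block of another index. -/
theorem reflTransGen_of_block {q q' : State} (h : q.component = 1) (h' : q'.component = 1) :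
    Relation.ReflTransGen A65.NonSigEdge q q' := by
  have circ : ∀ x i, Relation.ReflTransGen A65.NonSigEdge q (.circ x i) := by
    intro x i
    refine Relation.ReflTransGen.trans (.single ?_) (reflTransGen_circ .p x i)
    cases q with
    | circ z j => exact nonSigEdge (.circ_reset z j i)
    | sqr z j => exact nonSigEdge (.sqr_reset z j i)
    | _ => cases h
  cases q' with
  | circ x i => exact circ x i
  | sqr x i =>
    obtain ⟨z, hz⟩ := exists_advances i
    obtain ⟨j, hj⟩ := exists_ne i
    exact ((circ z j).tail (nonSigEdge (.circ_other z j i hz hj.symm))).trans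
      (reflTransGen_sqr .p x i)
  | _ => cases h'

theorem isNormal_A65 : A65.IsNormal := by
  rintro p q ⟨l, h₁, h₂⟩
  have hc := (h₁.resolve_right h₂).component_eq
  have cases3 : ∀ c : Fin 3, c = 0 ∨ c = 1 ∨ c = 2 := by decide
  rcases cases3 p.component with h | h | h
  · exact reflTransGen_of_top (State.component_eq_zero.1 (hc.trans h)) (State.component_eq_zero.1 h)
  · exact reflTransGen_of_block (hc.trans h) h
  · have two : ∀ q : State, q.component = 2 → q = .Y := by
      rintro (_ | _ | _ | _ | _ | _ | _) h <;> first | rfl | cases h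
    rw [two p h, two q (hc.trans h)]

/-! ### Reach-covering -/

theorem reach_nonSig {q q' : State} {l : Letter} (h : NonSig q l q') :
    (some q, l, some q') ∈ A65.reach.Δ :=
  .inl ⟨q, l, q', .inl h, h.not_sig, rfl⟩

theorem reach_sig {q q' : State} {l : Letter} (h : Sig q l q') :
    (some q, l, none) ∈ A65.reach.F :=
  .inl ⟨q, l, q', h, rfl⟩

theorem reach_none (l : Letter) : (none, l, none) ∈ A65.reach.F := .inr ⟨l, rfl⟩

theorem reach_cases {q : State} {l : Letter} {s : Option State}
    (h : (some q, l, s) ∈ A65.reach.Δ) :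
    (∃ q', s = some q' ∧ NonSig q l q') ∨ s = none ∧ ∃ q', Sig q l q' := by
  rcases h with ⟨_, _, q', h₁, h₂, e⟩ | ⟨_, _, q', h, e⟩ | ⟨_, e⟩
  · cases e
    exact .inl ⟨q', rfl, h₁.resolve_right h₂⟩
  · cases e
    exact .inr ⟨rfl, q', h⟩
  · cases e

/-- In `reach` the significant transitions end in the sink, so the top, the only place with a
choice, is never entered. -/
theorem reachDeterministic_of_not_isTop {q : State} (hq : ¬ q.IsTop) :
    A65.ReachDeterministic q := by
  refine BuchiAutomaton.deterministicFrom_of_closed A65.reach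
    (fun s => ∀ q, s = some q → ¬ q.IsTop) ?_ ?_ (by rintro _ ⟨⟩; exact hq)
  · rintro (_ | p) l s hp hs
    · rcases hs with ⟨_, _, _, _, _, e⟩ | ⟨_, _, _, _, e⟩ | ⟨_, e⟩
      · cases e
      · cases e
      · cases e
        rintro _ ⟨⟩
    · rcases reach_cases hs with ⟨q', rfl, h⟩ | ⟨rfl, -⟩
      · rintro _ ⟨⟩ ht
        rw [← State.component_eq_zero, h.component_eq, State.component_eq_zero] at ht
        exact hp p rfl ht
      · rintro _ ⟨⟩
  · rintro (_ | p) l s₁ s₂ hp hs₁ hs₂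
    · have : ∀ s, (none, l, s) ∈ A65.reach.Δ → s = none := by
        rintro s (⟨_, _, _, _, _, e⟩ | ⟨_, _, _, _, e⟩ | ⟨_, e⟩)
        · cases e
        · cases e
        · cases e; rfl
      rw [this _ hs₁, this _ hs₂]
    · have hp := hp p rfl
      rcases reach_cases hs₁ with ⟨q₁, rfl, h₁⟩ | ⟨rfl, q₁, h₁⟩ <;>
        rcases reach_cases hs₂ with ⟨q₂, rfl, h₂⟩ | ⟨rfl, q₂, h₂⟩
      · rw [h₁.eq_stepTo hp false, h₂.eq_stepTo hp false]
      · rw [h₂.eq_stepTo false, ← h₁.eq_stepTo hp false] at h₂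
        exact absurd h₂ h₁.not_sig
      · rw [h₁.eq_stepTo false, ← h₂.eq_stepTo hp false] at h₁
        exact absurd h₁ h₂.not_sig
      · rfl

/-- The top component covers the square blocks: it expects an advance on the index of the
block. -/
inductive Covers : Option State → Option State → Prop
  | won (s : Option State) : Covers s none
  | top (x : Pos) (i : Fin 6) :
      Covers (some (.sqr x i)) (some (topState (x, decide (3 ≤ i.val))))

/-- Eve's guess is the kind of the index of Adam's square. His significant advance on that index is
therefore matched, and a reset wins for Eve at once. If he advances on another index `j`, Eve either
advances too and wins, or returns to `I`, which is compatible with any guess and so covers the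
square of `j`. -/
theorem Covers.step {s e : Option State} {l : Letter} {s' : Option State} (h : Covers s e)
    (hs : (s, l, s') ∈ A65.reach.Δ) :
    ∃ e', (e, l, e') ∈ A65.reach.Δ ∧ Covers s' e' ∧
      ((s, l, s') ∈ A65.reach.F → (e, l, e') ∈ A65.reach.F) := by
  cases h with
  | won s => exact ⟨none, .inr (reach_none l), .won _, fun _ => reach_none l⟩
  | top x i =>
    have hwin : ∀ {q'}, Sig (topState (x, decide (3 ≤ i.val))) l q' →
        ∃ e', (some (topState (x, decide (3 ≤ i.val))), l, e') ∈ A65.reach.Δ ∧ Covers s' e' ∧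
        ((some (State.sqr x i), l, s') ∈ A65.reach.F →
          (some (topState (x, decide (3 ≤ i.val))), l, e') ∈ A65.reach.F) := fun h =>
      ⟨none, A65.reach.F_subset (reach_sig h), .won _, fun _ => reach_sig h⟩
    rcases reach_cases hs with ⟨q', rfl, h⟩ | ⟨rfl, q', h⟩
    · have hnot : (some (State.sqr x i), l, some q') ∉ A65.reach.F := by
        rintro (⟨_, _, _, _, e⟩ | ⟨_, e⟩) <;> cases e
      cases h with
      | sqr_next _ x' _ _ hx =>
        rcases stepTo_mem (decide (3 ≤ i.val)) (topState (x, decide (3 ≤ i.val))) l with h | h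
        · rw [topState_step hx] at h
          exact ⟨_, reach_nonSig h, .top _ _, fun h => absurd h hnot⟩
        · exact hwin h
      | sqr_other _ _ j hx hij =>
        by_cases ha : (topState (x, decide (3 ≤ i.val))).TopAdvances j
        · exact hwin (.top_num _ _ ha)
        · exact ⟨_, reach_nonSig (.top_num _ _ (topState_isTop _) ha), .top .p j,
            fun h => absurd h hnot⟩
      | top_y _ h | top_num _ _ h => simp [State.IsTop] at h
      | sqr_reset _ _ j => exact hwin (.top_reset _ j (topState_isTop _))
    · cases h with
      | top_num _ _ h => simp [State.TopAdvances] at h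
      | top_reset _ _ h => simp [State.IsTop] at h
      | sqr_same _ _ hx => exact hwin (.top_num _ _ (topAdvances_topState.2 (.inl ⟨hx, rfl⟩)))

theorem exists_topState {q : State} (h : q.IsTop) :
    ∃ (x : Pos) (i : Fin 6), q = topState (x, decide (3 ≤ i.val)) := by
  rcases h with rfl | rfl | rfl | rfl
  -- The indices `0` and `3` merely represent the kinds `E` and `F`.
  · exact ⟨.p, 0, rfl⟩
  · exact ⟨.q, 3, rfl⟩
  · exact ⟨.r, 3, rfl⟩
  · exact ⟨.t, 0, rfl⟩

theorem hasReachCovering_A65 : A65.HasReachCovering := by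
  intro p
  have hequiv : ∀ q, A65.LangEquiv p q := fun q => (langFrom_eq p).trans (langFrom_eq q).symm
  by_cases hp : p.IsTop
  · obtain ⟨x, i, rfl⟩ := exists_topState hp
    exact ⟨.sqr x i, reachDeterministic_of_not_isTop (by simp [State.IsTop]), hequiv _,
      BuchiAutomaton.simulates_of_direct _ _ Covers (fun _ _ _ _ => Covers.step) (.top x i)⟩
  · exact ⟨p, reachDeterministic_of_not_isTop hp, rfl, BuchiAutomaton.simulates_refl _ _⟩

theorem isSimplified_A65 : A65.IsSimplified :=
  ⟨fun _ _ _ p' q' _ _ _ => (langFrom_eq p').trans (langFrom_eq q').symm, isNormal_A65,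
    hasReachCovering_A65⟩

end SuccinctHD

theorem mainTheorem4 :
    Fintype.card SuccinctHD.State = 65 ∧
    SuccinctHD.A65.lang = SuccinctHD.L65 ∧
    SuccinctHD.A65.IsSimplified ∧
    SuccinctHD.A65.IsHistoryDeterministic := by
  exact ⟨by decide, SuccinctHD.langFrom_eq _, SuccinctHD.isSimplified_A65,
    SuccinctHD.isHistoryDeterministic_A65⟩
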